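/- Let $\alpha \approx 0.78265213$ be the second largest real root of $$54675a^4-2442195a^3+2182800a^2-115424a-96429 .$$ Put $\gamma_k=(k+1)/k$ for odd $k$ and $\gamma_k=1$ for even $k$. For $\beta\in\mathbb R$ say that a sequence $\{a_k\}_{k\ge1}$ of nonnegative real numbers is $\beta$-admissible if $$a_{2j-1}\ge \frac{2j}{2j-1}\,a_{2j}\quad (j\ge 1),\qquad a_2\ge \frac{3\beta}{4}\,a_3,\qquad a_{2j}\ge \frac{2j+1}{2j+2}\,a_{2j+1}\quad (j\ge 2).$$ (i) If $\{a_k\}$ is $\alpha$-admissible, then $\sum_{k=1}^n a_k\sin(kx)\ge 0$ for all $x\in[0,\pi]$ and all $n\ge1$. (ii) Write $\{a_k\}\succeq\{b_k\}$ if $a_k=0$ implies $b_k=0$ and, over the indices $k$ with $a_k\ne 0$, the quotients $b_k/a_k$ are nonnegative and nonincreasing. The sequence $\{2\alpha,\alpha,\gamma_3,\gamma_4,\gamma_5,\dots\}$ is maximal among the $\alpha$-admissible sequences: it is $\alpha$-admissible, and $\{2\alpha,\alpha,\gamma_3,\gamma_4,\dots\}\succeq\{a_k\}$ for every $\alpha$-admissible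 $\{a_k\}$. (iii) The value $\alpha$ is best possible: for every $\beta<\alpha$ the fifth partial sum $$2\beta\sin x+\beta\sin 2x+\gamma_3\sin 3x+\gamma_4\sin 4x+\gamma_5\sin 5x$$ takes a negative value somewhere in $[0,\pi]$, while for $0<\beta<\alpha$ the sequence $\{2\beta,\beta,\gamma_3,\gamma_4,\dots\}$ is $\beta$-admissible. -/

import Mathlib

/-- The quartic polynomial `54675 a⁴ - 2442195 a³ + 2182800 a² - 115424 a - 96429`. -/
def quartic (a : ℝ) : ℝ :=
  54675 * a ^ 4 - 2442195 * a ^ 3 + 2182800 * a ^ 2 - 115424 * a - 96429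

/-- The real roots of the quartic that are not its largest real root. -/
def nonLargestRoots : Set ℝ :=
  {x | quartic x = 0 ∧ ∃ y, quartic y = 0 ∧ x < y}

/-- The second largest real root of the quartic. That this supremum is attained
(so that it really is the second largest root) is part of the theorem. -/
noncomputable def alpha : ℝ := sSup nonLargestRoots

/-- The `n`-th partial sum of `∑ a_k sin (k x)`. Sequences are indexed by `k ≥ 1`;
the value `a 0` is never used. -/
noncomputable def sinePartialSum (a : ℕ → ℝ) (n : ℕ) (x : ℝ) : ℝ :=
  ∑ k ∈ Finset.Icc 1 n, a k * Real.sin (k * x)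

/-- The `n`-th partial sum of `∑ a_k sin (k x)` is nonnegative on `[0, π]`. -/
def IsNN (a : ℕ → ℝ) (n : ℕ) : Prop :=
  ∀ x ∈ Set.Icc (0 : ℝ) Real.pi, 0 ≤ sinePartialSum a n x

/-- `∑ a_k sin (k x)` is a P-sum on `[0, π]`: all its partial sums are nonnegative there. -/
def IsPSum (a : ℕ → ℝ) : Prop :=
  ∀ n : ℕ, IsNN a n

/-- The coefficient conditions with parameter `β` in the place of `α`, for a sequence
of nonnegative numbers. -/
structure Admissible (β : ℝ) (a : ℕ → ℝ) : Prop where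
  nonneg : ∀ k : ℕ, 1 ≤ k → 0 ≤ a k
  vietoris : ∀ j : ℕ, 1 ≤ j → a (2 * j - 1) ≥ (2 * j : ℝ) / (2 * j - 1) * a (2 * j)
  two_three : a 2 ≥ 3 * β / 4 * a 3
  even_odd : ∀ j : ℕ, 2 ≤ j → a (2 * j) ≥ (2 * j + 1 : ℝ) / (2 * j + 2) * a (2 * j + 1)

/-- `γ_k = (k + 1) / k` for odd `k` and `γ_k = 1` for even `k`. -/
noncomputable def gammaSeq (k : ℕ) : ℝ :=
  if Odd k then ((k : ℝ) + 1) / k else 1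

/-- The sequence `2β, β, γ₃, γ₄, γ₅, …`. -/
noncomputable def phiOne (β : ℝ) (k : ℕ) : ℝ :=
  if k = 1 then 2 * β else if k = 2 then β else gammaSeq k

/-- The comparison order `{a_k} ⪰ {b_k}`: `b` vanishes wherever `a` does and, over the indices
with `a_k ≠ 0`, the quotients `b_k / a_k` are nonincreasing and nonnegative. -/
structure Dominates (a b : ℕ → ℝ) : Prop where
  zero : ∀ k : ℕ, 1 ≤ k → a k = 0 → b k = 0
  anti : ∀ i k : ℕ, 1 ≤ i → i ≤ k → a i ≠ 0 → a k ≠ 0 → b k / a k ≤ b i / a i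
  nonneg : ∀ k : ℕ, 1 ≤ k → a k ≠ 0 → 0 ≤ b k / a k

/-! The sequence `phiOne α` turns every admissibility inequality into an equality, so the quotients
of any admissible sequence by it are nonincreasing (`dominates_phiOne`), and Abel summation
(`IsPSum.of_dominates`) reduces everything to the partial sums `S_n` of `phiOne α`.

For `n = 5`, `S_5 / sin x` is a quartic in `z = cos x`, linear in the parameter. At `α` it has a
double root `c` in `(-1, 1)` and is otherwise positive; below `α` it is negative at `c`. Eliminating
`c` gives `quartic`.

For `n ≥ 2`, `S_n` depends on `β` only through `2β sin x (1 + cos x)`, so it increases with `β`, and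
for `n ≠ 5` the rational value `3913 / 5000 < α` already suffices. For `n < 15` this is a finite
check of integer polynomials in `cos x`. For `n ≥ 15`, `S_n` is a conjugate Dirichlet kernel plus a
partial sum of the square wave, minus a correction in the first two terms. The square wave part is
at least `π / 4 - 1 / (2 m sin x)` (`oddSum_ge`). This settles the range `π / n ≤ x ≤ π - π / n`; at
the two ends the terms, or pairs of terms, are nonnegative. -/

/-! ### A verified subdivision test for nonnegativity of integer polynomials on `[0, 1]` -/

/-- The value at `x` of the polynomial with coefficient list `p`, constant term first. -/
def polyEval : List ℤ → ℝ → ℝ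
  | [], _ => 0
  | a :: p, x => a + x * polyEval p x

/-- Sum of polynomials given by coefficient lists. -/
def polyAdd : List ℤ → List ℤ → List ℤ
  | [], q => q
  | p, [] => p
  | a :: p, b :: q => (a + b) :: polyAdd p q

/-- Scalar multiple of a polynomial given by its coefficient list. -/
def polySMul (c : ℤ) (p : List ℤ) : List ℤ := p.map (c * ·)

/-- Coefficient list of `c + (u + v x) p`. -/
def polyMulLinear (u v : ℤ) : ℤ → List ℤ → List ℤ
  | c, [] => [c]
  | c, a :: p => (c + u * a) :: polyMulLinear u v (v * a) p

/-- Coefficient list of `p ((u + v x) / w)`, multiplied by `w` to the power of the formal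
degree of `p`. -/
def polyComp (u v w : ℤ) : List ℤ → List ℤ
  | [] => []
  | a :: p => polyMulLinear u v (a * w ^ p.length) (polyComp u v w p)

/-- A lower bound on `[0, 1]` read off from the Horner scheme. -/
def hornerLower : List ℤ → ℤ
  | [] => 0
  | a :: p => a + min 0 (hornerLower p)

/-- Bisects `[0, 1]` at most `d` times until the Horner bound is nonnegative on every piece. -/
def nonnegCheck : ℕ → List ℤ → Bool
  | 0, p => decide (0 ≤ hornerLower p)
  | d + 1, p => decide (0 ≤ hornerLower p) ||
      (nonnegCheck d (polyComp 0 1 2 p) && nonnegCheck d (polyComp 1 1 2 p))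

theorem polyEval_add (p q : List ℤ) (x : ℝ) :
    polyEval (polyAdd p q) x = polyEval p x + polyEval q x := by
  induction p generalizing q with
  | nil => simp [polyAdd, polyEval]
  | cons a p ih =>
    cases q with
    | nil => simp [polyAdd, polyEval]
    | cons b q => simp only [polyAdd, polyEval, ih]; push_cast; ring

theorem polyEval_smul (c : ℤ) (p : List ℤ) (x : ℝ) :
    polyEval (polySMul c p) x = c * polyEval p x := by
  induction p with
  | nil => simp [polySMul, polyEval]
  | cons a p ih =>
    simp only [polySMul, List.map_cons, polyEval] at ih ⊢
    rw [ih]; push_cast; ring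

theorem polyEval_mulLinear (u v c : ℤ) (p : List ℤ) (x : ℝ) :
    polyEval (polyMulLinear u v c p) x = c + (u + v * x) * polyEval p x := by
  induction p generalizing c with
  | nil => simp [polyMulLinear, polyEval]
  | cons a p ih =>
    simp only [polyMulLinear, polyEval, ih]
    push_cast; ring

/-- The formal degree is `p.length - 1`; the extra factor `w` on the left avoids the truncated
subtraction and covers the empty list. -/
theorem polyEval_comp (u v : ℤ) {w : ℤ} (hw : 0 < w) (p : List ℤ) (x : ℝ) :
    w * polyEval (polyComp u v w p) x = w ^ p.length * polyEval p ((u + v * x) / w) := by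
  have hw' : (w : ℝ) ≠ 0 := by exact_mod_cast hw.ne'
  induction p with
  | nil => simp [polyComp, polyEval]
  | cons a p ih =>
    have e : ((u : ℝ) + v * x) = w * ((u + v * x) / w) := by field_simp
    simp only [polyComp, polyEval_mulLinear, polyEval, List.length_cons]
    push_cast
    linear_combination ((u + v * x) : ℝ) * ih +
      w ^ p.length * polyEval p ((u + v * x) / w) * e

theorem polyEval_nonneg_of_comp (u v : ℤ) {w : ℤ} (hw : 0 < w) (p : List ℤ) (x : ℝ)
    (h : 0 ≤ polyEval (polyComp u v w p) x) : 0 ≤ polyEval p ((u + v * x) / w) := by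
  have hw' : (0 : ℝ) < w := by exact_mod_cast hw
  have e := polyEval_comp u v hw p x
  have h2 : 0 ≤ (w : ℝ) ^ p.length * polyEval p ((u + v * x) / w) := e ▸ mul_nonneg hw'.le h
  exact nonneg_of_mul_nonneg_right h2 (by positivity)

theorem hornerLower_le (p : List ℤ) {x : ℝ} (h0 : 0 ≤ x) (h1 : x ≤ 1) :
    (hornerLower p : ℝ) ≤ polyEval p x := by
  induction p with
  | nil => simp [hornerLower, polyEval]
  | cons a p ih =>
    simp only [hornerLower, polyEval]
    push_cast
    gcongr
    rcases le_total 0 (polyEval p x) with h | h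
    · exact (min_le_left _ _).trans (mul_nonneg h0 h)
    · exact (min_le_right _ _).trans (ih.trans (by nlinarith))

theorem polyEval_nonneg_of_check (d : ℕ) (p : List ℤ) (h : nonnegCheck d p = true) {x : ℝ}
    (h0 : 0 ≤ x) (h1 : x ≤ 1) : 0 ≤ polyEval p x := by
  have base : ∀ p : List ℤ, 0 ≤ hornerLower p → ∀ {x : ℝ}, 0 ≤ x → x ≤ 1 → 0 ≤ polyEval p x :=
    fun p hp x h0 h1 => le_trans (by exact_mod_cast hp) (hornerLower_le p h0 h1)
  induction d generalizing p x with
  | zero => exact base p (by simpa [nonnegCheck] using h) h0 h1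
  | succ d ih =>
    simp only [nonnegCheck, Bool.or_eq_true, Bool.and_eq_true, decide_eq_true_eq] at h
    rcases h with h | ⟨hl, hr⟩
    · exact base p h h0 h1
    · rcases le_total x (1 / 2) with hx | hx
      · have := polyEval_nonneg_of_comp 0 1 two_pos p (2 * x)
          (ih _ hl (by linarith) (by linarith))
        convert this using 2
        push_cast; ring
      · have := polyEval_nonneg_of_comp 1 1 two_pos p (2 * x - 1)
          (ih _ hr (by linarith) (by linarith))
        convert this using 2
        push_cast; ring

/-- Nonnegativity on an interval `[u / w, (u + v) / w]` from the subdivision test. -/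
theorem polyEval_nonneg_on (d : ℕ) (u : ℤ) {v w : ℤ} (p : List ℤ) (hv : 0 < v) (hw : 0 < w)
    (h : nonnegCheck d (polyComp u v w p) = true) {x : ℝ}
    (h0 : u ≤ w * x) (h1 : w * x ≤ u + v) : 0 ≤ polyEval p x := by
  have hv' : (0 : ℝ) < v := by exact_mod_cast hv
  have hw' : (0 : ℝ) < w := by exact_mod_cast hw
  have := polyEval_nonneg_of_comp u v hw p ((w * x - u) / v) <|
    polyEval_nonneg_of_check d _ h (div_nonneg (by linarith) hv'.le)
      ((div_le_one hv').2 (by linarith))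
  convert this using 2
  field_simp; ring

/-! ### Small partial sums -/

/-- Coefficient lists of the Chebyshev polynomials with `sin (k x) = sin x * U_{k-1} (cos x)`,
for the indices `k` and `k + 1`. -/
def sinePolyPair : ℕ → List ℤ × List ℤ
  | 0 => ([], [1])
  | k + 1 => ((sinePolyPair k).2,
      polyAdd (0 :: polySMul 2 (sinePolyPair k).2) (polySMul (-1) (sinePolyPair k).1))

/-- Coefficient list of the `n`-th partial sum of `∑ a k * sin (k x)`, divided by `sin x`,
as a polynomial in `cos x`. -/
def partialPoly (a : ℕ → ℤ) : ℕ → List ℤ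
  | 0 => []
  | n + 1 => polyAdd (partialPoly a n) (polySMul (a (n + 1)) (sinePolyPair (n + 1)).1)

theorem sin_eq_sinePolyPair (k : ℕ) (x : ℝ) :
    Real.sin (k * x) = Real.sin x * polyEval (sinePolyPair k).1 (Real.cos x) ∧
    Real.sin ((k + 1 : ℕ) * x) = Real.sin x * polyEval (sinePolyPair k).2 (Real.cos x) := by
  induction k with
  | zero => simp [sinePolyPair, polyEval]
  | succ k ih =>
    refine ⟨ih.2, ?_⟩
    simp only [sinePolyPair, polyEval_add, polyEval, polyEval_smul]
    have h1 : Real.sin ((k + 1 + 1 : ℕ) * x) =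
        2 * Real.cos x * Real.sin ((k + 1 : ℕ) * x) - Real.sin (k * x) := by
      have e1 : ((k + 1 + 1 : ℕ) : ℝ) * x = (k + 1 : ℕ) * x + x := by push_cast; ring
      have e2 : (k : ℝ) * x = (k + 1 : ℕ) * x - x := by push_cast; ring
      rw [e1, e2, Real.sin_add, Real.sin_sub]; ring
    rw [h1, ih.1, ih.2]; push_cast; ring

theorem sinePartialSum_succ (a : ℕ → ℝ) (n : ℕ) (x : ℝ) :
    sinePartialSum a (n + 1) x = sinePartialSum a n x + a (n + 1) * Real.sin ((n + 1 : ℕ) * x) := by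
  simp [sinePartialSum, Finset.sum_Icc_succ_top]

theorem sinePartialSum_intCast (a : ℕ → ℤ) (n : ℕ) (x : ℝ) :
    sinePartialSum (fun k => a k) n x = Real.sin x * polyEval (partialPoly a n) (Real.cos x) := by
  induction n with
  | zero => simp [sinePartialSum, partialPoly, polyEval]
  | succ n ih =>
    rw [sinePartialSum_succ, ih, partialPoly, polyEval_add, polyEval_smul,
      (sin_eq_sinePolyPair (n + 1) x).1]
    ring

theorem sinePartialSum_const_mul (d : ℝ) (a : ℕ → ℝ) (n : ℕ) (x : ℝ) :
    sinePartialSum (fun k => d * a k) n x = d * sinePartialSum a n x := by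
  simp only [sinePartialSum, Finset.mul_sum, mul_assoc]

/-- The sequence `phiOne (3913 / 5000)` up to the index `14`, with denominators cleared. -/
def phiInt (k : ℕ) : ℤ :=
  if k = 1 then 90090 * 3913 else if k = 2 then 45045 * 3913
  else if k % 2 = 1 then 225225000 + 225225000 / k else 225225000

/-- Here `225225000 = 5000 * 45045`, and `45045` is the least common multiple of the odd numbers up
to `13`, so the integer division in `phiInt` is exact. -/
theorem phiInt_eq {k : ℕ} (h1 : 1 ≤ k) (hk : k < 15) :
    (phiInt k : ℝ) = 225225000 * phiOne (3913 / 5000) k := by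
  interval_cases k <;> norm_num [phiInt, phiOne, gammaSeq, Nat.odd_iff]

/-- The substitution `-1 + 2 t` carries `[0, 1]` to the range `[-1, 1]` of the cosine. The index `5`
must be left out: since `3913 / 5000 < α`, that sum takes negative values. -/
theorem partialPoly_check : ∀ n < 15, n ≠ 5 →
    nonnegCheck 8 (polyComp (-1) 2 1 (partialPoly phiInt n)) = true := by
  decide +kernel

theorem isNN_phiOne_small {n : ℕ} (hn : n < 15) (h5 : n ≠ 5) :
    IsNN (phiOne (3913 / 5000)) n := by
  intro x hx
  have e : sinePartialSum (fun k => phiInt k) n x =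
      225225000 * sinePartialSum (phiOne (3913 / 5000)) n x := by
    rw [← sinePartialSum_const_mul]
    refine Finset.sum_congr rfl fun k hk => ?_
    rw [Finset.mem_Icc] at hk
    simp only [phiInt_eq hk.1 (by omega : k < 15)]
  have h : 0 ≤ sinePartialSum (fun k => phiInt k) n x := by
    rw [sinePartialSum_intCast]
    refine mul_nonneg (Real.sin_nonneg_of_nonneg_of_le_pi hx.1 hx.2) ?_
    refine polyEval_nonneg_on 8 (-1) _ two_pos one_pos (partialPoly_check n hn h5) ?_ ?_
    · push_cast; linarith [Real.neg_one_le_cos x]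
    · push_cast; linarith [Real.cos_le_one x]
  linarith

/-! ### Analytic lower bounds for the large partial sums -/

/-- The partial sums `∑_{j < m} sin ((2 j + 1) x) / (2 j + 1)` of the square wave. -/
noncomputable def oddSum (m : ℕ) (x : ℝ) : ℝ :=
  ∑ j ∈ Finset.range m, Real.sin ((2 * j + 1) * x) / (2 * j + 1)

theorem two_sin_mul_sum_cos_odd (m : ℕ) (x : ℝ) :
    2 * Real.sin x * ∑ j ∈ Finset.range m, Real.cos ((2 * j + 1) * x) = Real.sin (2 * m * x) := by
  induction m with
  | zero => simp
  | succ m ih =>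
    rw [Finset.sum_range_succ, mul_add, ih]
    have e1 : 2 * ((m + 1 : ℕ) : ℝ) * x = (2 * m + 1) * x + x := by push_cast; ring
    have e2 : 2 * (m : ℝ) * x = (2 * m + 1) * x - x := by ring
    rw [e1, e2, Real.sin_add, Real.sin_sub]; ring

theorem hasDerivAt_oddSum (m : ℕ) (x : ℝ) :
    HasDerivAt (oddSum m) (∑ j ∈ Finset.range m, Real.cos ((2 * j + 1) * x)) x := by
  unfold oddSum
  refine HasDerivAt.fun_sum fun j _ => ?_
  have h0 : (2 * (j : ℝ) + 1) ≠ 0 := by positivity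
  have h := (((hasDerivAt_id x).const_mul (2 * (j : ℝ) + 1)).sin).div_const (2 * (j : ℝ) + 1)
  refine h.congr_deriv ?_
  simp only [id]
  field_simp

theorem oddSum_pi_sub (m : ℕ) (x : ℝ) : oddSum m (Real.pi - x) = oddSum m x := by
  refine Finset.sum_congr rfl fun j _ => ?_
  congr 1
  have e : (2 * (j : ℝ) + 1) * (Real.pi - x) =
      (Real.pi - (2 * j + 1) * x) + j * (2 * Real.pi) := by ring
  rw [e, Real.sin_add_nat_mul_two_pi, Real.sin_pi_sub]

theorem oddSum_pi_div_two (m : ℕ) :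
    oddSum m (Real.pi / 2) = ∑ j ∈ Finset.range m, (-1 : ℝ) ^ j / (2 * j + 1) := by
  refine Finset.sum_congr rfl fun j _ => ?_
  congr 1
  have e : (2 * (j : ℝ) + 1) * (Real.pi / 2) = Real.pi / 2 + j * Real.pi := by ring
  rw [e, Real.sin_add_nat_mul_pi]; simp

/-- A one-sided error bound for the Leibniz series. -/
theorem pi_div_four_le_leibniz {m : ℕ} (hm : 1 ≤ m) :
    Real.pi / 4 ≤ ∑ j ∈ Finset.range m, (-1 : ℝ) ^ j / (2 * j + 1) +
      ((-1) ^ m + 1) / (4 * m) := by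
  have anti : Antitone fun j : ℕ => (1 : ℝ) / (2 * j + 1) := by
    intro i j hij
    have : (i : ℝ) ≤ j := by exact_mod_cast hij
    exact one_div_le_one_div_of_le (by positivity) (by linarith)
  have lim := Real.tendsto_sum_pi_div_four
  have key : ∀ k : ℕ, Real.pi / 4 ≤
      ∑ j ∈ Finset.range (2 * k + 1), (-1 : ℝ) ^ j / (2 * j + 1) := by
    intro k
    have := anti.tendsto_le_alternating_series (l := Real.pi / 4) (by
      refine lim.congr fun n => Finset.sum_congr rfl fun j _ => ?_
      ring) k
    refine this.trans (le_of_eq (Finset.sum_congr rfl fun j _ => ?_))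
    ring
  -- An odd number of terms overshoots `π / 4`. For `m = 2k` the next term `1 / (4k + 1)` is added,
  -- and it is below the correction `2 / (8k)`.
  rcases Nat.even_or_odd' m with ⟨k, rfl | rfl⟩
  · have h := key k
    rw [Finset.sum_range_succ] at h
    have hk : (1 : ℝ) ≤ k := by
      have : 1 ≤ k := by omega
      exact_mod_cast this
    have e : ((-1 : ℝ) ^ (2 * k)) = 1 := by simp
    rw [e] at h ⊢
    have h2 : (1 : ℝ) / (2 * ((2 * k : ℕ) : ℝ) + 1) ≤ (1 + 1) / (4 * ((2 * k : ℕ) : ℝ)) := by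
      push_cast
      rw [div_le_div_iff₀ (by positivity) (by positivity)]
      linarith
    linarith
  · have h := key k
    have e : ((-1 : ℝ) ^ (2 * k + 1)) = -1 := by rw [pow_succ]; simp
    rw [e]
    simpa using h

/-- The derivative of `oddSum m` is `sin (2 m t) / (2 sin t)`. Adding `(1 + cos (2 m t)) / (4 m sin
t)` cancels this oscillating term and leaves a nonpositive derivative, so the sum `H` decreases to
its value at `π / 2`, which the Leibniz bound puts above `π / 4`. -/
theorem oddSum_ge_of_le_pi_div_two {m : ℕ} (hm : 1 ≤ m) {x : ℝ} (h0 : 0 < x)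
    (h1 : x ≤ Real.pi / 2) :
    Real.pi / 4 - (1 + Real.cos (2 * m * x)) / (4 * m * Real.sin x) ≤ oddSum m x := by
  have hm' : (0 : ℝ) < m := by exact_mod_cast hm
  set H : ℝ → ℝ := fun t => oddSum m t + (1 + Real.cos (2 * m * t)) / (4 * m * Real.sin t) with hH
  have hs : ∀ t ∈ Set.Icc x (Real.pi / 2), 0 < Real.sin t := fun t ht =>
    Real.sin_pos_of_pos_of_lt_pi (h0.trans_le ht.1) (by linarith [ht.2, Real.pi_pos])
  have hd : ∀ t ∈ Set.Icc x (Real.pi / 2), HasDerivAt H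
      (-((1 + Real.cos (2 * m * t)) * Real.cos t / (4 * m * Real.sin t ^ 2))) t := by
    intro t ht
    have st := hs t ht
    have d1 := ((hasDerivAt_id t).const_mul (2 * (m : ℝ))).cos.const_add 1
    have d2 := (Real.hasDerivAt_sin t).const_mul (4 * (m : ℝ))
    have d := (hasDerivAt_oddSum m t).add (d1.div d2 (by positivity))
    refine d.congr_deriv ?_
    have e := two_sin_mul_sum_cos_odd m t
    have e' : ∑ j ∈ Finset.range m, Real.cos ((2 * j + 1) * t) =
        Real.sin (2 * m * t) / (2 * Real.sin t) := by
      rw [eq_div_iff (by positivity)]; linarith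
    rw [e']
    simp only [id]
    field_simp
    ring
  have anti : AntitoneOn H (Set.Icc x (Real.pi / 2)) := by
    refine antitoneOn_of_hasDerivWithinAt_nonpos (convex_Icc _ _)
      (fun t ht => (hd t ht).continuousAt.continuousWithinAt)
      (fun t ht => (hd t (interior_subset ht)).hasDerivWithinAt) fun t ht => ?_
    have ht := interior_subset ht
    have := hs t ht
    have c0 : 0 ≤ Real.cos t := Real.cos_nonneg_of_neg_pi_div_two_le_of_le
      (by linarith [ht.1, Real.pi_pos]) ht.2
    have c1 : 0 ≤ 1 + Real.cos (2 * m * t) := by linarith [Real.neg_one_le_cos (2 * m * t)]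
    rw [neg_nonpos]
    positivity
  have h := anti (Set.left_mem_Icc.2 h1) (Set.right_mem_Icc.2 h1) h1
  have hl := pi_div_four_le_leibniz hm
  have e : 2 * (m : ℝ) * (Real.pi / 2) = m * Real.pi := by ring
  simp only [hH, oddSum_pi_div_two, e, Real.cos_nat_mul_pi, Real.sin_pi_div_two, mul_one] at h
  rw [add_comm ((-1 : ℝ) ^ m) 1] at hl
  linarith

theorem oddSum_ge {m : ℕ} (hm : 1 ≤ m) {x : ℝ} (h0 : 0 < x) (h1 : x < Real.pi) :
    Real.pi / 4 - 1 / (2 * m * Real.sin x) ≤ oddSum m x := by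
  have hm' : (0 : ℝ) < m := by exact_mod_cast hm
  have main : ∀ y : ℝ, 0 < y → y ≤ Real.pi / 2 →
      Real.pi / 4 - 1 / (2 * m * Real.sin y) ≤ oddSum m y := by
    intro y hy hy'
    have hs : 0 < Real.sin y := Real.sin_pos_of_pos_of_lt_pi hy (by linarith [Real.pi_pos])
    refine le_trans ?_ (oddSum_ge_of_le_pi_div_two hm hy hy')
    have : (1 + Real.cos (2 * m * y)) / (4 * m * Real.sin y) ≤ 1 / (2 * m * Real.sin y) := by
      rw [div_le_div_iff₀ (by positivity) (by positivity)]
      have := Real.cos_le_one (2 * m * y)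
      have : 0 < (m : ℝ) * Real.sin y := by positivity
      nlinarith
    linarith
  rcases le_total x (Real.pi / 2) with h | h
  · exact main x h0 h
  · have := main (Real.pi - x) (by linarith) (by linarith)
    rwa [oddSum_pi_sub, Real.sin_pi_sub] at this

theorem two_sin_half_mul_sum_sin (n : ℕ) (x : ℝ) :
    2 * Real.sin (x / 2) * sinePartialSum (fun _ => 1) n x =
      Real.cos (x / 2) - Real.cos ((n + 1 / 2) * x) := by
  induction n with
  | zero => simp only [sinePartialSum]; norm_num; ring_nf
  | succ n ih =>
    rw [sinePartialSum_succ, mul_add, ih]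
    have e1 : ((n : ℝ) + 1 / 2) * x = (n + 1 : ℕ) * x - x / 2 := by push_cast; ring
    have e2 : (((n + 1 : ℕ) : ℝ) + 1 / 2) * x = (n + 1 : ℕ) * x + x / 2 := by push_cast; ring
    rw [e1, e2, Real.cos_add, Real.cos_sub]; ring

theorem sinePartialSum_gammaSeq (n : ℕ) (x : ℝ) :
    sinePartialSum gammaSeq n x = sinePartialSum (fun _ => 1) n x + oddSum ((n + 1) / 2) x := by
  induction n with
  | zero => simp [sinePartialSum, oddSum]
  | succ n ih =>
    rw [sinePartialSum_succ, sinePartialSum_succ, ih]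
    rcases Nat.even_or_odd' n with ⟨k, rfl | rfl⟩
    · have e1 : (2 * k + 1 + 1) / 2 = k + 1 := by omega
      have e2 : (2 * k + 1) / 2 = k := by omega
      have e3 : oddSum (k + 1) x = oddSum k x + Real.sin ((2 * k + 1) * x) / (2 * k + 1) :=
        Finset.sum_range_succ _ _
      rw [e1, e2, e3, gammaSeq, if_pos ⟨k, rfl⟩]
      have : (2 * (k : ℝ) + 1) ≠ 0 := by positivity
      push_cast
      field_simp
      ring
    · have e1 : (2 * k + 1 + 1 + 1) / 2 = k + 1 := by omega
      have e2 : (2 * k + 1 + 1) / 2 = k + 1 := by omega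
      rw [e1, e2, gammaSeq, if_neg (by rw [Nat.not_odd_iff_even]; exact ⟨k + 1, by ring⟩)]
      ring

/-- Only the first two coefficients differ, by `2 (1 - β)` and `1 - β`. -/
theorem sinePartialSum_phiOne (β : ℝ) {n : ℕ} (hn : 2 ≤ n) (x : ℝ) :
    sinePartialSum (phiOne β) n x = sinePartialSum gammaSeq n x -
      (1 - β) * (2 * Real.sin x * (1 + Real.cos x)) := by
  induction n, hn using Nat.le_induction with
  | base =>
    have h2 : ¬ Odd 2 := by decide
    simp [sinePartialSum, Finset.sum_Icc_succ_top, phiOne, gammaSeq, h2, Real.sin_two_mul]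
    ring
  | succ n hn ih =>
    rw [sinePartialSum_succ, ih, sinePartialSum_succ, phiOne, if_neg (by omega), if_neg (by omega)]
    ring

/-- The lower bound from which all estimates for large `n` start. -/
theorem sinePartialSum_phiOne_ge {β : ℝ} {n : ℕ} (hn : 2 ≤ n) {x : ℝ} (h0 : 0 < x)
    (h1 : x < Real.pi) :
    (Real.cos (x / 2) - Real.cos ((n + 1 / 2) * x)) / (2 * Real.sin (x / 2)) + Real.pi / 4 -
      1 / (2 * ((n + 1) / 2 : ℕ) * Real.sin x) - (1 - β) * (2 * Real.sin x * (1 + Real.cos x)) ≤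
    sinePartialSum (phiOne β) n x := by
  have hs : 0 < Real.sin (x / 2) := Real.sin_pos_of_pos_of_lt_pi (by linarith) (by linarith)
  have h := oddSum_ge (m := (n + 1) / 2) (by omega) h0 h1
  have e : sinePartialSum (fun _ => 1) n x =
      (Real.cos (x / 2) - Real.cos ((n + 1 / 2) * x)) / (2 * Real.sin (x / 2)) := by
    rw [← two_sin_half_mul_sum_sin]; field_simp
  rw [sinePartialSum_phiOne β hn, sinePartialSum_gammaSeq, e]
  linarith

/-! ### Nonnegativity of the large partial sums -/

theorem phiOne_nonneg {β : ℝ} (hβ : 0 ≤ β) (k : ℕ) : 0 ≤ phiOne β k := by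
  unfold phiOne gammaSeq
  split_ifs <;> positivity

theorem sinePartialSum_phiOne_nonneg_near_zero {β : ℝ} (hβ : 0 ≤ β) {n : ℕ} {x : ℝ} (h0 : 0 ≤ x)
    (h1 : n * x ≤ Real.pi) : 0 ≤ sinePartialSum (phiOne β) n x := by
  refine Finset.sum_nonneg fun k hk => mul_nonneg (phiOne_nonneg hβ k) ?_
  have hk : (k : ℝ) ≤ n := by exact_mod_cast (Finset.mem_Icc.1 hk).2
  exact Real.sin_nonneg_of_nonneg_of_le_pi (by positivity)
    ((mul_le_mul_of_nonneg_right hk h0).trans h1)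

theorem mul_sin_le_sin_mul {t θ : ℝ} (ht0 : 0 ≤ t) (ht1 : t ≤ 1) (h0 : 0 ≤ θ)
    (h1 : θ ≤ Real.pi) : t * Real.sin θ ≤ Real.sin (t * θ) := by
  have := strictConcaveOn_sin_Icc.concaveOn.2 (⟨h0, h1⟩ : θ ∈ Set.Icc 0 Real.pi)
    (⟨le_rfl, Real.pi_pos.le⟩ : (0 : ℝ) ∈ Set.Icc 0 Real.pi) ht0 (sub_nonneg.2 ht1) (by ring)
  simpa using this

theorem sin_nat_mul_pi_sub (k : ℕ) (y : ℝ) :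
    Real.sin (k * (Real.pi - y)) = -(-1) ^ k * Real.sin (k * y) := by
  rw [mul_sub, Real.sin_sub, Real.sin_nat_mul_pi, Real.cos_nat_mul_pi]; ring

/-- At `π - y` the signs alternate. Consecutive terms pair up to `(2j+2)/(2j+1) sin((2j+1)y) -
sin((2j+2)y)`, which is nonnegative because `sin θ / θ` decreases on `(0, π]`. -/
theorem sinePartialSum_phiOne_even_nonneg_near_pi {β : ℝ} (hβ : 0 ≤ β) {j : ℕ} (hj : 1 ≤ j) {y : ℝ}
    (h0 : 0 ≤ y) (h1 : 2 * j * y ≤ Real.pi) :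
    0 ≤ sinePartialSum (phiOne β) (2 * j) (Real.pi - y) := by
  induction j, hj using Nat.le_induction with
  | base =>
    have h2 : sinePartialSum (phiOne β) (2 * 1) (Real.pi - y) =
        β * (2 * Real.sin y * (1 - Real.cos y)) := by
      have e : Real.sin (2 * (Real.pi - y)) = -(2 * Real.sin y * Real.cos y) := by
        rw [Real.sin_two_mul, Real.sin_pi_sub, Real.cos_pi_sub]; ring
      simp [sinePartialSum, Finset.sum_Icc_succ_top, phiOne, e]
      ring
    rw [h2]
    have : 0 ≤ Real.sin y := Real.sin_nonneg_of_nonneg_of_le_pi h0 (by push_cast at h1; linarith)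
    have : 0 ≤ 1 - Real.cos y := by linarith [Real.cos_le_one y]
    positivity
  | succ j hj ih =>
    push_cast at h1
    have ih := ih (by linarith)
    have e : 2 * (j + 1) = 2 * j + 1 + 1 := by ring
    rw [e, sinePartialSum_succ, sinePartialSum_succ, sin_nat_mul_pi_sub, sin_nat_mul_pi_sub]
    have p1 : (-1 : ℝ) ^ (2 * j + 1) = -1 := by rw [pow_succ]; simp
    have p2 : (-1 : ℝ) ^ (2 * j + 1 + 1) = 1 := by rw [pow_succ, p1]; simp
    have g1 : phiOne β (2 * j + 1) = (2 * j + 2) / (2 * j + 1) := by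
      rw [phiOne, if_neg (by omega), if_neg (by omega), gammaSeq, if_pos ⟨j, rfl⟩]
      push_cast; ring
    have g2 : phiOne β (2 * j + 1 + 1) = 1 := by
      rw [phiOne, if_neg (by omega), if_neg (by omega), gammaSeq,
        if_neg (by rw [Nat.not_odd_iff_even]; exact ⟨j + 1, by ring⟩)]
    rw [p1, p2, g1, g2]
    have h := mul_sin_le_sin_mul (t := (2 * j + 1) / (2 * j + 2)) (θ := (2 * j + 2) * y)
      (by positivity) (by rw [div_le_one (by positivity)]; linarith) (by positivity) (by linarith)
    have e2 : (2 * (j : ℝ) + 1) / (2 * j + 2) * ((2 * j + 2) * y) = (2 * j + 1) * y := by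
      field_simp
    rw [e2, div_mul_eq_mul_div, div_le_iff₀ (by positivity)] at h
    have e3 : ((2 * j + 1 + 1 : ℕ) : ℝ) * y = (2 * j + 2) * y := by push_cast; ring
    have h' : Real.sin ((2 * j + 2) * y) ≤
        (2 * j + 2) / (2 * j + 1) * Real.sin ((2 * j + 1) * y) := by
      rw [div_mul_eq_mul_div, le_div_iff₀ (by positivity)]; linarith
    rw [e3]
    push_cast
    linarith

theorem sinePartialSum_phiOne_nonneg_near_pi {β : ℝ} (hβ : 0 ≤ β) {n : ℕ} (hn : 2 ≤ n) {y : ℝ}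
    (h0 : 0 ≤ y) (h1 : n * y ≤ Real.pi) :
    0 ≤ sinePartialSum (phiOne β) n (Real.pi - y) := by
  rcases Nat.even_or_odd' n with ⟨j, rfl | rfl⟩
  · exact sinePartialSum_phiOne_even_nonneg_near_pi hβ (by omega) h0 (by push_cast at h1; exact h1)
  · have h2 : 2 * (j : ℝ) * y ≤ Real.pi := by push_cast at h1; linarith
    have := sinePartialSum_phiOne_even_nonneg_near_pi hβ (by omega : 1 ≤ j) h0 h2
    rw [sinePartialSum_succ, sin_nat_mul_pi_sub]
    have p1 : (-1 : ℝ) ^ (2 * j + 1) = -1 := by rw [pow_succ]; simp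
    have s := Real.sin_nonneg_of_nonneg_of_le_pi (by positivity) h1
    have := mul_nonneg (phiOne_nonneg hβ (2 * j + 1)) s
    rw [p1]
    linarith

/-- The crude form of the basic lower bound, with the number of odd terms replaced by a real
lower bound `N / 2` and the oscillating cosine by an upper bound `C`. -/
theorem sinePartialSum_phiOne_ge_crude {β : ℝ} (hβ : 3913 / 5000 ≤ β) {n : ℕ} (hn : 2 ≤ n)
    {x N C : ℝ} (h0 : 0 < x) (h1 : x < Real.pi) (hN0 : 0 < N) (hN : N ≤ 2 * ((n + 1) / 2 : ℕ))
    (hC : Real.cos ((n + 1 / 2) * x) ≤ C) :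
    (Real.cos (x / 2) - C) / (2 * Real.sin (x / 2)) + Real.pi / 4 - 1 / (N * Real.sin x) -
      1087 / 5000 * (2 * Real.sin x * (1 + Real.cos x)) ≤ sinePartialSum (phiOne β) n x := by
  refine le_trans ?_ (sinePartialSum_phiOne_ge hn h0 h1)
  have hs : 0 < Real.sin x := Real.sin_pos_of_pos_of_lt_pi h0 h1
  have hs2 : 0 < Real.sin (x / 2) := Real.sin_pos_of_pos_of_lt_pi (by linarith) (by linarith)
  have hc : 0 ≤ 1 + Real.cos x := by linarith [Real.neg_one_le_cos x]
  have a : (1 - β) * (2 * Real.sin x * (1 + Real.cos x)) ≤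
      1087 / 5000 * (2 * Real.sin x * (1 + Real.cos x)) := by
    refine mul_le_mul_of_nonneg_right (by linarith) (by positivity)
  have b : 1 / (2 * ((n + 1) / 2 : ℕ) * Real.sin x) ≤ 1 / (N * Real.sin x) := by gcongr
  have c : (Real.cos (x / 2) - C) / (2 * Real.sin (x / 2)) ≤
      (Real.cos (x / 2) - Real.cos ((n + 1 / 2) * x)) / (2 * Real.sin (x / 2)) := by gcongr
  linarith

theorem natCast_le_two_mul_half (n : ℕ) : (n : ℝ) ≤ 2 * ((n + 1) / 2 : ℕ) := by
  have : n ≤ 2 * ((n + 1) / 2) := by omega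
  exact_mod_cast this

theorem sinePartialSum_phiOne_nonneg_left {β : ℝ} (hβ : 3913 / 5000 ≤ β) {n : ℕ} (hn : 2 ≤ n)
    {x : ℝ} (h0 : 0 < x) (h1 : x ≤ 1 / 5) (hnx : Real.pi ≤ n * x) :
    0 ≤ sinePartialSum (phiOne β) n x := by
  have hpi := Real.pi_gt_d4
  have hn0 : (0 : ℝ) < n := by positivity
  refine le_trans ?_ (sinePartialSum_phiOne_ge_crude hβ hn h0 (by linarith) hn0
    (natCast_le_two_mul_half n) (Real.cos_le_one _))
  have sx := Real.sin_gt_sub_cube h0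
  have sx' := Real.sin_lt h0
  have sh := Real.sin_gt_sub_cube (x := x / 2) (by linarith)
  have ch := Real.one_sub_sq_div_two_le_cos (x := x / 2)
  have cx := Real.cos_le_one x
  have hx2 : x ^ 2 ≤ 1 / 25 := by nlinarith
  have sx2 : 99 / 100 * x ≤ Real.sin x := by nlinarith
  have sh2 : 99 / 200 * x ≤ Real.sin (x / 2) := by nlinarith
  have a : 1 / (n * Real.sin x) ≤ 1 / 3 := by
    apply one_div_le_one_div_of_le (by norm_num)
    have : n * (99 / 100 * x) ≤ n * Real.sin x := by gcongr
    nlinarith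
  have b : -(1 / 20) ≤ (Real.cos (x / 2) - 1) / (2 * Real.sin (x / 2)) := by
    rw [le_div_iff₀ (by linarith)]
    nlinarith
  have c : 2 * Real.sin x * (1 + Real.cos x) ≤ 4 / 5 := by
    have : 0 < Real.sin x := by linarith
    nlinarith
  linarith

/-- Near `π` the kernel can cost almost `1 / 2`, leaving about `0.285` of `π / 4` for `1 / (n sin
y)`. The bound `n y ≥ π` would not be enough, whence the threshold `37 / 10`. -/
theorem sinePartialSum_phiOne_nonneg_right_far {β : ℝ} (hβ : 3913 / 5000 ≤ β) {n : ℕ}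
    (hn : 2 ≤ n) {y : ℝ} (h0 : 0 < y) (h1 : y ≤ 1 / 5) (hny : 37 / 10 ≤ n * y) :
    0 ≤ sinePartialSum (phiOne β) n (Real.pi - y) := by
  have hpi := Real.pi_gt_d4
  have hn0 : (0 : ℝ) < n := by positivity
  refine le_trans ?_ (sinePartialSum_phiOne_ge_crude hβ hn (by linarith) (by linarith) hn0
    (natCast_le_two_mul_half n) (Real.cos_le_one _))
  have e : (Real.pi - y) / 2 = Real.pi / 2 - y / 2 := by ring
  rw [e, Real.cos_pi_div_two_sub, Real.sin_pi_div_two_sub, Real.sin_pi_sub, Real.cos_pi_sub]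
  have sy := Real.sin_gt_sub_cube h0
  have sy' := Real.sin_lt h0
  have sh := Real.sin_gt_sub_cube (x := y / 2) (by linarith)
  have ch := Real.one_sub_sq_div_two_le_cos (x := y / 2)
  have cy := Real.one_sub_sq_div_two_le_cos (x := y)
  have hy2 : y ^ 2 ≤ 1 / 25 := by nlinarith
  have sy2 : 99 / 100 * y ≤ Real.sin y := by nlinarith
  have a : 1 / (n * Real.sin y) ≤ 1 / (366 / 100) := by
    apply one_div_le_one_div_of_le (by norm_num)
    have : n * (99 / 100 * y) ≤ n * Real.sin y := by gcongr
    nlinarith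
  have b : -(1 / 2) ≤ (Real.sin (y / 2) - 1) / (2 * Real.cos (y / 2)) := by
    rw [le_div_iff₀ (by nlinarith)]
    nlinarith
  have c : 2 * Real.sin y * (1 + -Real.cos y) ≤ 1 / 125 := by
    calc 2 * Real.sin y * (1 + -Real.cos y) ≤ 2 * (1 / 5) * (1 / 50) := by
          gcongr
          · linarith [Real.cos_le_one y]
          · linarith
          · nlinarith
      _ = 1 / 125 := by norm_num
  linarith

theorem abs_cos_half_odd_mul_pi_sub (n : ℕ) (y : ℝ) :
    |Real.cos ((n + 1 / 2) * (Real.pi - y))| = |Real.sin ((n + 1 / 2) * y - Real.pi)| := by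
  have e : ((n : ℝ) + 1 / 2) * (Real.pi - y) =
      (Real.pi / 2 - (n + 1 / 2) * y) + n * Real.pi := by ring
  rw [e, Real.cos_add_nat_mul_pi, abs_mul, abs_pow, abs_neg, abs_one, one_pow, one_mul,
    Real.cos_pi_div_two_sub, Real.sin_sub_pi, abs_neg]

theorem sinePartialSum_phiOne_nonneg_right_near {β : ℝ} (hβ : 3913 / 5000 ≤ β) {n : ℕ}
    (hn : 2 ≤ n) {y : ℝ} (h0 : 0 < y) (h1 : y ≤ 1 / 5) (hny : Real.pi ≤ n * y)
    (hny' : n * y ≤ 37 / 10) : 0 ≤ sinePartialSum (phiOne β) n (Real.pi - y) := by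
  have hpi := Real.pi_gt_d4
  have hn0 : (0 : ℝ) < n := by positivity
  -- Here `(n + 1/2) y - π` lies between `0` and `3.7 + 0.1 - 3.1415 < 0.7`, so the oscillating
  -- cosine stays away from `1`.
  have hC : Real.cos ((n + 1 / 2) * (Real.pi - y)) ≤ 7 / 10 := by
    refine (le_abs_self _).trans ?_
    rw [abs_cos_half_odd_mul_pi_sub]
    refine Real.abs_sin_le_abs.trans ?_
    rw [abs_of_nonneg (by linarith)]
    linarith
  refine le_trans ?_ (sinePartialSum_phiOne_ge_crude hβ hn (by linarith) (by linarith) hn0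
    (natCast_le_two_mul_half n) hC)
  have e : (Real.pi - y) / 2 = Real.pi / 2 - y / 2 := by ring
  rw [e, Real.cos_pi_div_two_sub, Real.sin_pi_div_two_sub, Real.sin_pi_sub, Real.cos_pi_sub]
  have sy := Real.sin_gt_sub_cube h0
  have sy' := Real.sin_lt h0
  have sh := Real.sin_pos_of_pos_of_lt_pi (x := y / 2) (by linarith) (by linarith)
  have ch := Real.one_sub_sq_div_two_le_cos (x := y / 2)
  have cy := Real.one_sub_sq_div_two_le_cos (x := y)
  have hy2 : y ^ 2 ≤ 1 / 25 := by nlinarith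
  have sy2 : 99 / 100 * y ≤ Real.sin y := by nlinarith
  have a : 1 / (n * Real.sin y) ≤ 1 / 3 := by
    apply one_div_le_one_div_of_le (by norm_num)
    have : n * (99 / 100 * y) ≤ n * Real.sin y := by gcongr
    nlinarith
  have b : -(36 / 100) ≤ (Real.sin (y / 2) - 7 / 10) / (2 * Real.cos (y / 2)) := by
    rw [le_div_iff₀ (by nlinarith)]
    nlinarith
  have c : 2 * Real.sin y * (1 + -Real.cos y) ≤ 1 / 125 := by
    calc 2 * Real.sin y * (1 + -Real.cos y) ≤ 2 * (1 / 5) * (1 / 50) := by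
          gcongr
          · linarith [Real.cos_le_one y]
          · linarith
          · nlinarith
      _ = 1 / 125 := by norm_num
  linarith

/-- The coefficients of `40000` times the numerator of the lower bound, as a rational function of
`tan (x / 4)`. -/
def middlePoly : List ℤ :=
  [-625, 31415, -162886, 94245, 487169, 62830, -887316, -62830, 587169, -94245, -82886, -31415,
    19375]

/-- The interval is `[21 / 420, 380 / 420] = [1 / 20, 19 / 21]`, the range of `tan (x / 4)` in the
middle region. -/
theorem middlePoly_check : nonnegCheck 6 (polyComp 21 359 420 middlePoly) = true := by
  decide +kernel

theorem middle_rational_bound {q : ℝ} (h0 : 1 / 20 ≤ q) (h1 : q ≤ 19 / 21) :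
    0 ≤ -q / 2 + 6283 / 8000 - (1 + q ^ 2) ^ 2 / (64 * q * (1 - q ^ 2)) -
      1087 / 5000 * (16 * q * (1 - q ^ 2) ^ 3 / (1 + q ^ 2) ^ 4) := by
  have h := polyEval_nonneg_on 6 21 middlePoly (by norm_num) (by norm_num) middlePoly_check
    (x := q) (by push_cast; linarith) (by push_cast; linarith)
  have hq : 0 < q := by linarith
  have hq2 : 0 < 1 - q ^ 2 := by nlinarith
  have e : -q / 2 + 6283 / 8000 - (1 + q ^ 2) ^ 2 / (64 * q * (1 - q ^ 2)) -
      1087 / 5000 * (16 * q * (1 - q ^ 2) ^ 3 / (1 + q ^ 2) ^ 4) =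
      polyEval middlePoly q / (40000 * q * (1 - q ^ 2) * (1 + q ^ 2) ^ 4) := by
    simp only [middlePoly, polyEval]
    push_cast
    field_simp
    ring
  rw [e]
  positivity

theorem sinePartialSum_phiOne_nonneg_middle {β : ℝ} (hβ : 3913 / 5000 ≤ β) {n : ℕ}
    (hn : 15 ≤ n) {x : ℝ} (h0 : 1 / 5 ≤ x) (h1 : x ≤ Real.pi - 1 / 5) :
    0 ≤ sinePartialSum (phiOne β) n x := by
  have hpi := Real.pi_gt_d4
  have hN : (16 : ℝ) ≤ 2 * ((n + 1) / 2 : ℕ) := by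
    have : 16 ≤ 2 * ((n + 1) / 2) := by omega
    exact_mod_cast this
  refine le_trans ?_ (sinePartialSum_phiOne_ge_crude hβ (by omega) (by linarith) (by linarith)
    (by norm_num) hN (Real.cos_le_one _))
  set q := Real.tan (x / 4) with hq
  have hcos : 0 < Real.cos (x / 4) :=
    Real.cos_pos_of_mem_Ioo ⟨by linarith, by linarith⟩
  have q0 : 1 / 20 ≤ q := by
    have := Real.le_tan (x := x / 4) (by linarith) (by linarith)
    linarith
  have q1 : q ≤ 19 / 21 := by
    set s := Real.tan (Real.pi / 4 - x / 4) with hs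
    have s0 : 1 / 20 ≤ s := by
      have := Real.le_tan (x := Real.pi / 4 - x / 4) (by linarith) (by linarith)
      linarith
    have hc : 0 < Real.cos (Real.pi / 4 - x / 4) :=
      Real.cos_pos_of_mem_Ioo ⟨by linarith, by linarith⟩
    -- The tangent subtraction formula; `s ≥ 1 / 20` then gives `q ≤ (1 - 1/20) / (1 + 1/20) = 19 /
    -- 21`.
    have e : s * (1 + q) = 1 - q := by
      have e1 : s * Real.cos (Real.pi / 4 - x / 4) = Real.sin (Real.pi / 4 - x / 4) :=
        Real.tan_mul_cos hc.ne'
      rw [Real.sin_sub, Real.cos_sub, Real.cos_pi_div_four, Real.sin_pi_div_four,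
        ← Real.tan_mul_cos hcos.ne', ← hq] at e1
      have h2 : Real.sqrt 2 / 2 * Real.cos (x / 4) ≠ 0 := by positivity
      refine mul_left_cancel₀ h2 ?_
      linear_combination e1
    nlinarith
  have hq2 : 0 < 1 - q ^ 2 := by nlinarith
  have hs : Real.sin (x / 4) = q * Real.cos (x / 4) := (Real.tan_mul_cos hcos.ne').symm
  have hC : Real.cos (x / 4) ^ 2 = 1 / (1 + q ^ 2) := by
    rw [eq_div_iff (by positivity)]
    have := Real.sin_sq_add_cos_sq (x / 4)
    rw [hs] at this
    linarith
  have sh : Real.sin (x / 2) = 2 * q / (1 + q ^ 2) := by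
    have : x / 2 = 2 * (x / 4) := by ring
    rw [this, Real.sin_two_mul, hs]
    linear_combination 2 * q * hC
  have ch : Real.cos (x / 2) = (1 - q ^ 2) / (1 + q ^ 2) := by
    have : x / 2 = 2 * (x / 4) := by ring
    rw [this, Real.cos_two_mul, hC]
    field_simp
    ring
  have sx : Real.sin x = 4 * q * (1 - q ^ 2) / (1 + q ^ 2) ^ 2 := by
    have : x = 2 * (x / 2) := by ring
    rw [this, Real.sin_two_mul, sh, ch]
    field_simp
    ring
  have cx : 1 + Real.cos x = 2 * ((1 - q ^ 2) / (1 + q ^ 2)) ^ 2 := by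
    have : x = 2 * (x / 2) := by ring
    rw [this, Real.cos_two_mul, ch]
    ring
  have hq0 : 0 < q := by linarith
  have h := middle_rational_bound q0 q1
  have e1 : (Real.cos (x / 2) - 1) / (2 * Real.sin (x / 2)) = -q / 2 := by
    rw [sh, ch]; field_simp; ring
  have e2 : 1 / (16 * Real.sin x) = (1 + q ^ 2) ^ 2 / (64 * q * (1 - q ^ 2)) := by
    rw [sx]; field_simp; ring
  have e3 : 2 * Real.sin x * (1 + Real.cos x) =
      16 * q * (1 - q ^ 2) ^ 3 / (1 + q ^ 2) ^ 4 := by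
    rw [sx, cx]; field_simp; ring
  rw [e1, e2, e3]
  linarith

theorem isNN_phiOne_large {β : ℝ} (hβ : 3913 / 5000 ≤ β) {n : ℕ} (hn : 15 ≤ n) :
    IsNN (phiOne β) n := by
  intro x hx
  obtain ⟨hx0, hxpi⟩ := hx
  have hβ0 : 0 ≤ β := by linarith
  have hn2 : 2 ≤ n := by omega
  have hn0 : (0 : ℝ) < n := by positivity
  rcases le_total (n * x) Real.pi with h | h
  · exact sinePartialSum_phiOne_nonneg_near_zero hβ0 hx0 h
  have hx0' : 0 < x := pos_of_mul_pos_right (Real.pi_pos.trans_le h) hn0.le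
  rcases le_total x (1 / 5) with h5 | h5
  · exact sinePartialSum_phiOne_nonneg_left hβ hn2 hx0' h5 h
  rcases le_total x (Real.pi - 1 / 5) with h6 | h6
  · exact sinePartialSum_phiOne_nonneg_middle hβ hn h5 h6
  obtain ⟨y, rfl⟩ : ∃ y, x = Real.pi - y := ⟨Real.pi - x, by ring⟩
  have hy0 : 0 ≤ y := by linarith
  rcases le_total (n * y) Real.pi with h7 | h7
  · exact sinePartialSum_phiOne_nonneg_near_pi hβ0 hn2 hy0 h7
  have hy0' : 0 < y := pos_of_mul_pos_right (Real.pi_pos.trans_le h7) hn0.le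
  rcases le_total (n * y) (37 / 10) with h8 | h8
  · exact sinePartialSum_phiOne_nonneg_right_near hβ hn2 hy0' (by linarith) h7 h8
  · exact sinePartialSum_phiOne_nonneg_right_far hβ hn2 hy0' (by linarith) h8

/-! ### The quartic and the fifth partial sum -/

/-- The critical value of `cos x` at which the fifth partial sum touches zero. -/
theorem exists_critical_cos : ∃ c : ℝ, 0.4229548441 < c ∧ c < 0.4229548442 ∧
    432 * c ^ 4 + 696 * c ^ 3 + 112 * c ^ 2 - 136 * c - 29 = 0 := by
  have hc : ContinuousOn (fun c : ℝ => 432 * c ^ 4 + 696 * c ^ 3 + 112 * c ^ 2 - 136 * c - 29)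
      (Set.Icc 0.4229548441 0.4229548442) := by fun_prop
  obtain ⟨c, hc, h⟩ := intermediate_value_Ioo (by norm_num) hc
    (show (0 : ℝ) ∈ Set.Ioo _ _ by constructor <;> norm_num)
  exact ⟨c, hc.1, hc.2, h⟩

/-- Expanding at `α` and dividing by `z - α`, a root `z = α + s` above `α` satisfies `54675 s³ = b
s² + c s + d` with `b, c, d > 0`. By Descartes' rule this has only one positive solution, so two
roots cannot lie above `α`. -/
theorem isGreatest_nonLargestRoots {α : ℝ} (h : quartic α = 0) (h0 : 0.7826 < α) (h1 : α < 0.7827) :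
    IsGreatest nonLargestRoots α := by
  have root_above : ∃ y, quartic y = 0 ∧ α < y := by
    have hc : ContinuousOn quartic (Set.Icc 1 100) := by unfold quartic; fun_prop
    obtain ⟨y, hy, e⟩ := intermediate_value_Icc (by norm_num) hc
      (show (0 : ℝ) ∈ Set.Icc _ _ by unfold quartic; constructor <;> norm_num)
    exact ⟨y, e, by linarith [hy.1]⟩
  refine ⟨⟨h, root_above⟩, ?_⟩
  rintro x ⟨hx, y, hy, hxy⟩
  by_contra! hlt
  have p2 : 0.7826 ^ 2 < α ^ 2 := by gcongr
  have p2' : α ^ 2 < 0.7827 ^ 2 := by gcongr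
  have p3 : 0.7826 ^ 3 < α ^ 3 := by gcongr
  have p3' : α ^ 3 < 0.7827 ^ 3 := by gcongr
  have taylor : ∀ z, α < z → quartic z = 0 →
      54675 * (z - α) ^ 3 = (2442195 - 4 * 54675 * α) * (z - α) ^ 2 +
        (3 * 2442195 * α - 2182800 - 6 * 54675 * α ^ 2) * (z - α) +
        (3 * 2442195 * α ^ 2 + 115424 - 4 * 54675 * α ^ 3 - 2 * 2182800 * α) := by
    intro z hz e
    have hz' : z - α ≠ 0 := by linarith
    refine mul_left_cancel₀ hz' ?_
    unfold quartic at e h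
    linear_combination e - h
  have tx := taylor x hlt hx
  have ty := taylor y (hlt.trans hxy) hy
  generalize hb : 2442195 - 4 * 54675 * α = b at tx ty
  generalize hcc : 3 * 2442195 * α - 2182800 - 6 * 54675 * α ^ 2 = c at tx ty
  generalize hd : 3 * 2442195 * α ^ 2 + 115424 - 4 * 54675 * α ^ 3 - 2 * 2182800 * α = d at tx ty
  have hb0 : 0 < b := by norm_num at *; linarith
  have hc0 : 0 < c := by norm_num at *; linarith
  have hd0 : 0 < d := by norm_num at *; linarith
  obtain ⟨s, rfl⟩ : ∃ s, x = α + s := ⟨x - α, by ring⟩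
  obtain ⟨t, rfl⟩ : ∃ t, y = α + t := ⟨y - α, by ring⟩
  simp only [add_sub_cancel_left] at tx ty
  have hs : 0 < s := by linarith
  have hst : s < t := by linarith
  have ht : 0 < t := hs.trans hst
  -- Eliminating the cubic terms from the two equations leaves a sum of positive terms when `s < t`.
  have e : b * (s ^ 2 * t ^ 2) * (t - s) + c * (s * t) * (t ^ 2 - s ^ 2) +
      d * (t ^ 3 - s ^ 3) = 0 := by
    linear_combination s ^ 3 * ty - t ^ 3 * tx
  have g1 : 0 < t - s := by linarith
  have g2 : 0 < t ^ 2 - s ^ 2 := by rw [sub_pos]; gcongr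
  have g3 : 0 < t ^ 3 - s ^ 3 := by rw [sub_pos]; gcongr
  have : 0 < b * (s ^ 2 * t ^ 2) * (t - s) + c * (s * t) * (t ^ 2 - s ^ 2) +
      d * (t ^ 3 - s ^ 3) := by positivity
  linarith

/-- Write `S_5 / sin x = 2 β (1 + z) + g(z)`. A double root at `c` means `2 β = -g'(c)`, the formula
for `alpha`, and `g(c) = (1 + c) g'(c)`, the quartic equation for `c`. -/
theorem exists_critical_cos_alpha : ∃ c : ℝ, 0.4229548441 < c ∧ c < 0.4229548442 ∧
    432 * c ^ 4 + 696 * c ^ 3 + 112 * c ^ 2 - 136 * c - 29 = 0 ∧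
    alpha = 2 + 136 / 15 * c - 12 * c ^ 2 - 192 / 5 * c ^ 3 ∧
    IsGreatest nonLargestRoots alpha ∧ 0.78265213 < alpha ∧ alpha < 0.78265214 := by
  obtain ⟨c, h0, h1, h⟩ := exists_critical_cos
  have p2 : 0.4229548441 ^ 2 < c ^ 2 := by gcongr
  have p2' : c ^ 2 < 0.4229548442 ^ 2 := by gcongr
  have p3 : 0.4229548441 ^ 3 < c ^ 3 := by gcongr
  have p3' : c ^ 3 < 0.4229548442 ^ 3 := by gcongr
  set α := 2 + 136 / 15 * c - 12 * c ^ 2 - 192 / 5 * c ^ 3 with hα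
  have lo : 0.78265213 < α := by norm_num at *; linarith
  have hi : α < 0.78265214 := by norm_num at *; linarith
  have hq : quartic α = 0 := by
    rw [hα, quartic]
    -- The cofactor is the quotient of `quartic (α(c))`, of degree `12` in `c`, by the quartic
    -- satisfied by `c`.
    linear_combination (353753 + 63941896 / 15 * c + 25834496 / 5 * c ^ 2 -
      1413956712 / 25 * c ^ 3 - 185330736 / 5 * c ^ 4 + 905278464 / 5 * c ^ 5 -
      247504896 / 25 * c ^ 6 - 2484338688 / 25 * c ^ 7 + 6879707136 / 25 * c ^ 8) * h
  have hg : IsGreatest nonLargestRoots α :=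
    isGreatest_nonLargestRoots hq (by norm_num at *; linarith) (by norm_num at *; linarith)
  have e : alpha = α := hg.csSup_eq
  exact ⟨c, h0, h1, h, e, e ▸ hg, e ▸ lo, e ▸ hi⟩

theorem sinePartialSum_phiOne_sub {n : ℕ} (hn : 2 ≤ n) (β β' x : ℝ) :
    sinePartialSum (phiOne β) n x = sinePartialSum (phiOne β') n x +
      (β - β') * (2 * Real.sin x * (1 + Real.cos x)) := by
  rw [sinePartialSum_phiOne β hn, sinePartialSum_phiOne β' hn]; ring

theorem sinePartialSum_phiOne_five (β x : ℝ) :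
    sinePartialSum (phiOne β) 5 x = Real.sin x * (2 * β * (1 + Real.cos x) +
      (96 / 5 * Real.cos x ^ 4 + 8 * Real.cos x ^ 3 - 136 / 15 * Real.cos x ^ 2 -
        4 * Real.cos x - 2 / 15)) := by
  have h2 : Real.sin (2 * x) = _ := (sin_eq_sinePolyPair 2 x).1
  have h3 : Real.sin (3 * x) = _ := (sin_eq_sinePolyPair 3 x).1
  have h4 : Real.sin (4 * x) = _ := (sin_eq_sinePolyPair 4 x).1
  have h5 : Real.sin (5 * x) = _ := (sin_eq_sinePolyPair 5 x).1
  simp [sinePolyPair, polyAdd, polySMul, polyEval] at h2 h3 h4 h5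
  norm_num [sinePartialSum, Finset.sum_Icc_succ_top, phiOne, gammaSeq, Nat.odd_iff, h2, h3, h4, h5]
  ring

theorem isNN_phiOne_alpha_five : IsNN (phiOne alpha) 5 := by
  obtain ⟨c, h0, h1, h, hα, -⟩ := exists_critical_cos_alpha
  intro x hx
  rw [sinePartialSum_phiOne_five]
  refine mul_nonneg (Real.sin_nonneg_of_nonneg_of_le_pi hx.1 hx.2) ?_
  generalize Real.cos x = z
  have e : 2 * alpha * (1 + z) + (96 / 5 * z ^ 4 + 8 * z ^ 3 - 136 / 15 * z ^ 2 - 4 * z - 2 / 15) =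
      (z - c) ^ 2 * (96 / 5 * (z + (c + 5 / 24)) ^ 2 +
        (192 / 5 * c ^ 2 + 8 * c - 136 / 15 - 5 / 6)) := by
    rw [hα]
    linear_combination (-2 / 15) * h
  rw [e]
  have : 0 ≤ 192 / 5 * c ^ 2 + 8 * c - 136 / 15 - 5 / 6 := by norm_num at *; nlinarith
  positivity

theorem not_isNN_phiOne_five {β : ℝ} (hβ : β < alpha) : ¬ IsNN (phiOne β) 5 := by
  obtain ⟨c, h0, h1, h, hα, -⟩ := exists_critical_cos_alpha
  intro hNN
  have h1' : c < 1 := by norm_num at *; linarith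
  have h0' : 0 < c := by norm_num at *; linarith
  have hcos : Real.cos (Real.arccos c) = c := Real.cos_arccos (by linarith) h1'.le
  have := hNN (Real.arccos c) ⟨Real.arccos_nonneg c, Real.arccos_le_pi c⟩
  rw [sinePartialSum_phiOne_five, hcos] at this
  have hs : 0 < Real.sin (Real.arccos c) := by
    rw [Real.sin_arccos]
    exact Real.sqrt_pos.2 (by nlinarith)
  have neg : 2 * β * (1 + c) + (96 / 5 * c ^ 4 + 8 * c ^ 3 - 136 / 15 * c ^ 2 - 4 * c - 2 / 15) =
      2 * (β - alpha) * (1 + c) := by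
    rw [hα]
    linear_combination (-2 / 15) * h
  rw [neg] at this
  have : 0 < Real.sin (Real.arccos c) * (2 * (alpha - β) * (1 + c)) := by
    have : 0 < alpha - β := by linarith
    positivity
  nlinarith

theorem isPSum_phiOne_alpha : IsPSum (phiOne alpha) := by
  obtain ⟨-, -, -, -, -, -, hlo, -⟩ := exists_critical_cos_alpha
  have hα : 3913 / 5000 ≤ alpha := by norm_num at *; linarith
  intro n
  rcases le_or_gt 15 n with hn | hn
  · exact isNN_phiOne_large hα hn
  rcases eq_or_ne n 5 with rfl | h5
  · exact isNN_phiOne_alpha_five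
  intro x hx
  rcases le_or_gt 2 n with h2 | h2
  -- Monotonicity in the parameter passes from `3913 / 5000` up to `alpha`.
  · rw [sinePartialSum_phiOne_sub h2 alpha (3913 / 5000)]
    have := isNN_phiOne_small hn h5 x hx
    have s := Real.sin_nonneg_of_nonneg_of_le_pi hx.1 hx.2
    have c : 0 ≤ 1 + Real.cos x := by linarith [Real.neg_one_le_cos x]
    have d : 0 ≤ alpha - 3913 / 5000 := by linarith
    positivity
  · have hn1 : (n : ℝ) ≤ 1 := by exact_mod_cast Nat.lt_succ_iff.1 h2
    exact sinePartialSum_phiOne_nonneg_near_zero (by linarith) hx.1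
      ((mul_le_of_le_one_left hx.1 hn1).trans hx.2)

/-! ### Comparison of admissible sequences -/

theorem phiOne_pos {β : ℝ} (hβ : 0 < β) {k : ℕ} (hk : 1 ≤ k) : 0 < phiOne β k := by
  unfold phiOne gammaSeq
  split_ifs <;> positivity

theorem phiOne_odd_even (β : ℝ) {j : ℕ} (hj : 1 ≤ j) :
    phiOne β (2 * j - 1) = (2 * j : ℝ) / (2 * j - 1) * phiOne β (2 * j) := by
  obtain ⟨i, rfl⟩ : ∃ i, j = i + 1 := ⟨j - 1, by omega⟩
  have e : 2 * (i + 1) - 1 = 2 * i + 1 := by omega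
  rw [e]
  rcases Nat.eq_zero_or_pos i with rfl | hi
  · simp [phiOne]; norm_num
  · rw [phiOne, phiOne, if_neg (by omega), if_neg (by omega), if_neg (by omega), if_neg (by omega),
      gammaSeq, gammaSeq, if_pos ⟨i, rfl⟩, if_neg (by simp)]
    push_cast
    ring_nf

theorem phiOne_two_three (β : ℝ) : phiOne β 2 = 3 * β / 4 * phiOne β 3 := by
  have h3 : Odd 3 := by decide
  simp [phiOne, gammaSeq, h3]
  ring

theorem phiOne_even_odd (β : ℝ) {j : ℕ} (hj : 2 ≤ j) :
    phiOne β (2 * j) = (2 * j + 1 : ℝ) / (2 * j + 2) * phiOne β (2 * j + 1) := by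
  rw [phiOne, phiOne, if_neg (by omega), if_neg (by omega), if_neg (by omega), if_neg (by omega),
    gammaSeq, gammaSeq, if_neg (by simp), if_pos ⟨j, rfl⟩]
  push_cast
  field_simp
  ring

theorem admissible_phiOne {β : ℝ} (hβ : 0 ≤ β) : Admissible β (phiOne β) where
  nonneg k _ := phiOne_nonneg hβ k
  vietoris _ hj := (phiOne_odd_even β hj).ge
  two_three := (phiOne_two_three β).ge
  even_odd _ hj := (phiOne_even_odd β hj).ge

theorem div_le_div_of_ratio {a a' p p' t : ℝ} (ht : 0 < t) (hp' : 0 < p') (hp : p = t * p')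
    (ha : t * a' ≤ a) : a' / p' ≤ a / p := by
  subst hp
  rw [div_le_div_iff₀ hp' (by positivity)]
  nlinarith

theorem dominates_phiOne {β : ℝ} (hβ : 0 < β) {a : ℕ → ℝ} (ha : Admissible β a) :
    Dominates (phiOne β) a := by
  have step : ∀ k, 1 ≤ k → a (k + 1) / phiOne β (k + 1) ≤ a k / phiOne β k := by
    intro k hk
    rcases Nat.even_or_odd' k with ⟨j, rfl | rfl⟩
    · have hp := phiOne_pos hβ (by omega : 1 ≤ 2 * j + 1)
      rcases eq_or_ne j 1 with rfl | hj
      · exact div_le_div_of_ratio (by positivity) hp (phiOne_two_three β) ha.two_three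
      · exact div_le_div_of_ratio (by positivity) hp (phiOne_even_odd β (by omega))
          (ha.even_odd j (by omega))
    · have h1 := phiOne_odd_even β (by omega : 1 ≤ j + 1)
      have h2 := ha.vietoris (j + 1) (by omega)
      have e : 2 * (j + 1) - 1 = 2 * j + 1 := by omega
      have e' : 2 * (j + 1) = 2 * j + 1 + 1 := by ring
      rw [e, e'] at h1 h2
      refine div_le_div_of_ratio ?_ (phiOne_pos hβ (by omega)) h1 h2
      push_cast
      apply div_pos <;> linarith [(Nat.cast_nonneg j : (0 : ℝ) ≤ j)]
  refine ⟨fun k hk h => absurd h (phiOne_pos hβ hk).ne', fun i k hi hik _ _ => ?_,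
    fun k hk _ => div_nonneg (ha.nonneg k hk) (phiOne_pos hβ hk).le⟩
  induction k, hik using Nat.le_induction with
  | base => exact le_rfl
  | succ k hik ih =>
    exact (step k (by omega)).trans (ih (phiOne_pos hβ (by omega)).ne')

/-- Abel summation: nonnegativity of all partial sums passes to dominated sequences. -/
theorem IsPSum.of_dominates {p a : ℕ → ℝ} (hp : ∀ k, 1 ≤ k → 0 < p k) (h : IsPSum p)
    (hd : Dominates p a) : IsPSum a := by
  intro n x hx
  -- In the induction the last term matches exactly, and replacing `a n / p n` by the next, smaller
  -- quotient only lowers the bound because the partial sum of `p` is nonnegative.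
  have main : ∀ n, a (n + 1) / p (n + 1) * sinePartialSum p (n + 1) x ≤
      sinePartialSum a (n + 1) x := by
    intro n
    induction n with
    | zero =>
      have := hp 1 le_rfl
      simp only [sinePartialSum, zero_add, Finset.Icc_self, Finset.sum_singleton]
      rw [← mul_assoc, div_mul_cancel₀ _ this.ne']
    | succ n ih =>
      have h1 := hp (n + 1) (by omega)
      have h2 := hp (n + 1 + 1) (by omega)
      rw [sinePartialSum_succ p, sinePartialSum_succ a, mul_add, ← mul_assoc,
        div_mul_cancel₀ _ h2.ne']
      have := mul_le_mul_of_nonneg_right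
        (hd.anti (n + 1) (n + 1 + 1) (by omega) (by omega) h1.ne' h2.ne') (h (n + 1) x hx)
      linarith
  cases n with
  | zero => simp [sinePartialSum]
  | succ n =>
    exact (mul_nonneg (hd.nonneg (n + 1) (by omega) (hp (n + 1) (by omega)).ne')
      (h (n + 1) x hx)).trans (main n)

theorem theorem1 :
    -- `α` is the second largest real root of the quartic, with its numerical value
    (IsGreatest nonLargestRoots alpha ∧ 0.78265213 < alpha ∧ alpha < 0.78265214) ∧
    -- sufficiency of the coefficient conditions
    (∀ a : ℕ → ℝ, Admissible alpha a → IsPSum a) ∧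
    -- the sequence `2α, α, γ₃, γ₄, …` is the greatest admissible one
    (Admissible alpha (phiOne alpha) ∧
      ∀ a : ℕ → ℝ, Admissible alpha a → Dominates (phiOne alpha) a) ∧
    -- `α` cannot be replaced by a smaller number
    (∀ β : ℝ, β < alpha →
      (0 < β → Admissible β (phiOne β)) ∧ ¬ IsNN (phiOne β) 5) := by
  obtain ⟨-, -, -, -, -, hg, hlo, hhi⟩ := exists_critical_cos_alpha
  have h0 : 0 < alpha := lt_trans (by norm_num) hlo
  exact ⟨⟨hg, hlo, hhi⟩,
    fun a ha => isPSum_phiOne_alpha.of_dominates (fun k hk => phiOne_pos h0 hk)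
      (dominates_phiOne h0 ha),
    ⟨admissible_phiOne h0.le, fun a ha => dominates_phiOne h0 ha⟩,
    fun β hβ => ⟨fun hβ0 => admissible_phiOne hβ0.le, not_isNN_phiOne_five hβ⟩⟩
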